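/- Conventions. Manifolds are smooth, finite-dimensional, Hausdorff, second countable and without boundary. For a manifold $N$, $\mathfrak{X}_c(N)$ denotes the compactly supported smooth vector fields on $N$ and $C^\infty_c(N)$ the compactly supported smooth functions. A singular foliation on $M$ is an involutive, locally finitely generated $C^\infty(M)$-submodule $\mathcal F$ of $\mathfrak X_c(M)$; locally finitely generated means that every point has an open neighbourhood $O$ and finitely many smooth vector fields $Y_1,\dots,Y_n$ on $O$ such that $fY_i\in\mathcal F$ (extended by zero) for all $f\in C_c^\infty(O)$, and every $Z\in\mathcal F$ with support in $O$ is of the form $\sum_i f_iY_i$ with $f_i\in C_c^\infty(O)$. For a smooth map $\varphi\colon U\to N$ and a set $\mathcal F$ of vector fields on $N$ put $$\varphi^{-1}(\mathcal F)=\Big\{X\in\mathfrak X_c(U): d\varphi(X)=\sum_{i} f_i\,(Y_i\circ\varphi)\ \text{(finite sum)},\ f_i\in C_c^\infty(U),\ Y_i\in\mathcal F\Big\}.$$ For a smooth map $f$ defined on $U$, $\Gamma_c(U,\ker df)$ denotes the $X\in\mathfrak X_c(U)$ with $df(X)=0$. A vector field $Z$ on $U$ is $\varphi$-related to $Y$ on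 $N$ if $d\varphi(Z_u)=Y_{\varphi(u)}$ for all $u\in U$. Let $G\rightrightarrows M$ be a Lie groupoid with source $\mathbf s$, target $\mathbf t$ and inversion $i$; $g,h$ are composable if $\mathbf s(g)=\mathbf t(h)$. Let $A=\ker(d\mathbf s)|_M$ be its Lie algebroid and $\mathcal B$ a singular subalgebroid of $A$, i.e. an involutive, locally finitely generated $C^\infty(M)$-submodule of $\Gamma_c(A)$. For $\alpha\in\Gamma_c(A)$ let $\overrightarrow{\alpha}_g=(R_g)_*\alpha_{\mathbf t(g)}$ and $\overleftarrow{\alpha}_g=(L_g)_*i_*\alpha_{\mathbf s(g)}$ be the associated right- and left-invariant vector fields on $G$, where $R_g$ and $L_g$ are right and left multiplication by $g$, and let $\overrightarrow{\mathcal B}$ and $\overleftarrow{\mathcal B}$ be the sets of finite $C_c^\infty(G)$-linear combinations of the fields $\overrightarrow{\alpha}$, respectively $\overleftarrow{\alpha}$, with $\alpha\in\mathcal B$. A smooth map $\varphi\colon U\to G$ from a manifold $U$ is a bisubmersion for $\mathcal B$ if (i) $\mathbf s\circ\varphi$ and $\mathbf t\circ\varphi$ are submersions $U\to M$; (ii)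 for every $\alpha\in\mathcal B$ there are smooth vector fields $Z$, $W$ on $U$ that are $\varphi$-related to $\overrightarrow\alpha$ and to $\overleftarrow\alpha$, respectively; (iii) $\varphi^{-1}(\overrightarrow{\mathcal B})=\Gamma_c(U,\ker d(\mathbf s\circ\varphi))$ and $\varphi^{-1}(\overleftarrow{\mathcal B})=\Gamma_c(U,\ker d(\mathbf t\circ\varphi))$. Proposition. Let $\mathcal F$ be a singular foliation on a manifold $M$, let $U$ be a manifold, and let $\mathbf t_U,\mathbf s_U\colon U\to M$ be submersions. The following are equivalent: 1) $(U,\mathbf t_U,\mathbf s_U)$ is a bisubmersion for $\mathcal F$ in the sense of Androulidakis and Skandalis, i.e. $$\mathbf t_U^{-1}(\mathcal F)=\Gamma_c(U,\ker d\mathbf t_U)+\Gamma_c(U,\ker d\mathbf s_U)=\mathbf s_U^{-1}(\mathcal F);$$ 2) the map $(\mathbf t_U,\mathbf s_U)\colon U\to M\times M$ is a bisubmersion, in the sense of (i)–(iii), for $\mathcal F$ regarded as a singular subalgebroid of $TM$, where $M\times M$ is the pair groupoid over $M$ ($\mathbf t(x,y)=x$, $\mathbf s(x,y)=y$, $(x,y)(y,z)=(x,z)$),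 whose Lie algebroid is identified with $TM$ by $v\in T_xM\mapsto(v,0)\in T_{(x,x)}(M\times M)$. -/

import Mathlib

open Set Topology
open scoped Manifold ContDiff

noncomputable section

namespace SingFol

section VectorFields

variable {E : Type*} [NormedAddCommGroup E] [NormedSpace ℝ E]
  {H : Type*} [TopologicalSpace H] (I : ModelWithCorners ℝ E H)
  {M : Type*} [TopologicalSpace M] [ChartedSpace H M]
  {E' : Type*} [NormedAddCommGroup E'] [NormedSpace ℝ E']
  {H' : Type*} [TopologicalSpace H'] (J : ModelWithCorners ℝ E' H')
  {N : Type*} [TopologicalSpace N] [ChartedSpace H' N]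

/-- `X` is a smooth vector field on the subset `O` of `M`. -/
def SmoothFieldOn [IsManifold I 1 M] (X : Π x : M, TangentSpace I x) (O : Set M) : Prop :=
  ContMDiffOn I I.tangent ∞ (fun x => (⟨x, X x⟩ : TangentBundle I M)) O

/-- `X` is a smooth vector field on `M`, i.e. an element of `𝔛(M)`. -/
def SmoothField [IsManifold I 1 M] (X : Π x : M, TangentSpace I x) : Prop :=
  ContMDiff I I.tangent ∞ (fun x => (⟨x, X x⟩ : TangentBundle I M))

/-- The support of a (not necessarily continuous) vector field. -/
def fieldSupport (X : Π x : M, TangentSpace I x) : Set M :=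
  closure {x | X x ≠ 0}

/-- The compactly supported smooth vector fields `𝔛_c(M)`. -/
def compactFields (M : Type*) [TopologicalSpace M] [ChartedSpace H M] [IsManifold I 1 M] :
    Set (Π x : M, TangentSpace I x) :=
  {X | SmoothField I X ∧ IsCompact (fieldSupport I X)}

/-- The compactly supported smooth real functions `C_c^∞(M)`. -/
def compactFunctions (M : Type*) [TopologicalSpace M] [ChartedSpace H M] : Set (M → ℝ) :=
  {f | ContMDiff I 𝓘(ℝ, ℝ) ∞ f ∧ HasCompactSupport f}

/-- `Span_{C_c^∞(M)} 𝒢`: the finite `C_c^∞(M)`-linear combinations of elements of `𝒢`. -/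
def compactSpan (𝒢 : Set (Π x : M, TangentSpace I x)) : Set (Π x : M, TangentSpace I x) :=
  {X | ∃ (n : ℕ) (f : Fin n → M → ℝ) (Y : Fin n → Π x : M, TangentSpace I x),
    (∀ i, f i ∈ compactFunctions I M) ∧ (∀ i, Y i ∈ 𝒢) ∧
    ∀ x, X x = ∑ i, f i x • Y i x}

/-- The vector field `X` on `M` is `φ`-related to the vector field `Y` on `N`. -/
def Related (φ : M → N) (X : Π x : M, TangentSpace I x) (Y : Π y : N, TangentSpace J y) : Prop :=
  ∀ p : M, mfderiv I J φ p (X p) = Y (φ p)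

/-- The pullback `φ⁻¹(𝓕)` of a set `𝓕` of vector fields on `N` along `φ : M → N`: the `X ∈ 𝔛_c(M)`
such that `dφ(X)` is a finite sum `∑ fᵢ (Yᵢ ∘ φ)` with `fᵢ ∈ C_c^∞(M)` and `Yᵢ ∈ 𝓕`. -/
def pullbackFields [IsManifold I 1 M] (φ : M → N) (𝓕 : Set (Π y : N, TangentSpace J y)) :
    Set (Π x : M, TangentSpace I x) :=
  {X | X ∈ compactFields I M ∧
    ∃ (n : ℕ) (f : Fin n → M → ℝ) (Y : Fin n → Π y : N, TangentSpace J y),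
      (∀ i, f i ∈ compactFunctions I M) ∧ (∀ i, Y i ∈ 𝓕) ∧
      ∀ p, mfderiv I J φ p (X p) = ∑ i, f i p • Y i (φ p)}

/-- `Γ_c(M, ker df)`: compactly supported smooth vector fields on `M` with values in `ker df`. -/
def compactKerFields [IsManifold I 1 M] (f : M → N) : Set (Π x : M, TangentSpace I x) :=
  {X | X ∈ compactFields I M ∧ ∀ p, mfderiv I J f p (X p) = 0}

/-- A singular foliation on `M`: an involutive, locally finitely generated `C^∞(M)`-submodule
of `𝔛_c(M)`. -/
structure SingularFoliation (M : Type*) [TopologicalSpace M] [ChartedSpace H M]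
    [IsManifold I 1 M] where
  carrier : Set (Π x : M, TangentSpace I x)
  subset_compactFields : carrier ⊆ compactFields I M
  zero_mem : (fun _ => 0) ∈ carrier
  add_mem : ∀ X ∈ carrier, ∀ Y ∈ carrier, (fun x => X x + Y x) ∈ carrier
  smul_mem : ∀ f : M → ℝ, ContMDiff I 𝓘(ℝ, ℝ) ∞ f → ∀ X ∈ carrier, (fun x => f x • X x) ∈ carrier
  involutive : ∀ X ∈ carrier, ∀ Y ∈ carrier, VectorField.mlieBracket I X Y ∈ carrier
  /-- Every point has an open neighbourhood `O` and finitely many vector fields `Yᵢ` on `O`, lying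
  in the global hull of `i^*𝓕 = {Z|_O : Z ∈ 𝓕, supp Z ⊆ O}`, such that every element of `i^*𝓕` is
  a `C_c^∞(O)`-linear combination of the `Yᵢ`. Functions in `C_c^∞(O)` and elements of `i^*𝓕` are
  identified with their extensions by zero to `M`. -/
  locally_fg : ∀ x₀ : M, ∃ O : Set M, IsOpen O ∧ x₀ ∈ O ∧
    ∃ (n : ℕ) (Y : Fin n → Π x : M, TangentSpace I x),
      (∀ i, SmoothFieldOn I (Y i) O) ∧
      (∀ i, ∀ f ∈ compactFunctions I M, tsupport f ⊆ O → (fun x => f x • Y i x) ∈ carrier) ∧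
      (∀ Z ∈ carrier, fieldSupport I Z ⊆ O →
        ∃ f : Fin n → M → ℝ, (∀ i, f i ∈ compactFunctions I M ∧ tsupport (f i) ⊆ O) ∧
          ∀ x, Z x = ∑ i, f i x • Y i x)

end VectorFields

section LieGroupoids

variable {E : Type*} [NormedAddCommGroup E] [NormedSpace ℝ E]
  {H : Type*} [TopologicalSpace H] (I : ModelWithCorners ℝ E H)
  (M : Type*) [TopologicalSpace M] [ChartedSpace H M]
  {E' : Type*} [NormedAddCommGroup E'] [NormedSpace ℝ E']
  {H' : Type*} [TopologicalSpace H'] (J : ModelWithCorners ℝ E' H')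
  (G : Type*) [TopologicalSpace G] [ChartedSpace H' G]

/-- A Lie groupoid `G ⇉ M` on given manifolds `G` and `M`. Elements `g`, `h` are composable if
`src g = tgt h`; the values of `mul` on non-composable pairs play no role. -/
structure LieGroupoid where
  src : G → M
  tgt : G → M
  one : M → G
  inv : G → G
  mul : G → G → G
  src_submersion : Manifold.IsSubmersion J I ∞ src
  tgt_submersion : Manifold.IsSubmersion J I ∞ tgt
  one_smooth : ContMDiff I J ∞ one
  inv_smooth : ContMDiff J J ∞ inv
  mul_smooth : ContMDiffOn (J.prod J) J ∞ (fun p : G × G => mul p.1 p.2) {p | src p.1 = tgt p.2}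
  src_one : ∀ x, src (one x) = x
  tgt_one : ∀ x, tgt (one x) = x
  src_inv : ∀ g, src (inv g) = tgt g
  tgt_inv : ∀ g, tgt (inv g) = src g
  src_mul : ∀ g h, src g = tgt h → src (mul g h) = src h
  tgt_mul : ∀ g h, src g = tgt h → tgt (mul g h) = tgt g
  mul_assoc : ∀ g h k, src g = tgt h → src h = tgt k → mul (mul g h) k = mul g (mul h k)
  one_mul : ∀ g, mul (one (tgt g)) g = g
  mul_one : ∀ g, mul g (one (src g)) = g
  inv_mul : ∀ g, mul (inv g) g = one (src g)
  mul_inv : ∀ g, mul g (inv g) = one (tgt g)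

namespace LieGroupoid

variable {I M J G}

/-- `Γ_c(A)`: the compactly supported smooth sections of the Lie algebroid
`A = ker (d src)|_M` of `𝒢`, as maps `x ↦ α x ∈ T_{1_x} G`. -/
def compactSections (𝒢 : LieGroupoid I M J G) [IsManifold J 1 G] :
    Set (Π x : M, TangentSpace J (𝒢.one x)) :=
  {α | ContMDiff I J.tangent ∞ (fun x => (⟨𝒢.one x, α x⟩ : TangentBundle J G)) ∧
    IsCompact (closure {x | α x ≠ 0}) ∧
    ∀ x, mfderiv J I 𝒢.src (𝒢.one x) (α x) = 0}

/-- The right-invariant vector field `g ↦ (R_g)_* α_{tgt g}` of a section `α` of `A`. Here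
`R_g : h ↦ h g` is defined on the source fibre `src⁻¹(tgt g)`, to which `α_{tgt g}` is tangent, so
its differential is taken within that fibre, at the point `1_{tgt g}`. It takes values in the
tangent space at `1_{tgt g} g = g`. -/
def rightInvariant (𝒢 : LieGroupoid I M J G) (α : Π x : M, TangentSpace J (𝒢.one x)) :
    Π g : G, TangentSpace J g := fun g =>
  (mfderivWithin J J (fun h => 𝒢.mul h g) {h | 𝒢.src h = 𝒢.tgt g} (𝒢.one (𝒢.tgt g))
    (α (𝒢.tgt g)) : TangentSpace J (𝒢.mul (𝒢.one (𝒢.tgt g)) g))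

/-- The left-invariant vector field `g ↦ (L_g)_* i_* α_{src g}` of a section `α` of `A`, where `i`
is the inversion and `L_g : h ↦ g h` is defined on the target fibre `tgt⁻¹(src g)`. -/
def leftInvariant (𝒢 : LieGroupoid I M J G) (α : Π x : M, TangentSpace J (𝒢.one x)) :
    Π g : G, TangentSpace J g := fun g =>
  (mfderivWithin J J (fun h => 𝒢.mul g h) {h | 𝒢.tgt h = 𝒢.src g} (𝒢.one (𝒢.src g))
    (mfderiv J J 𝒢.inv (𝒢.one (𝒢.src g)) (α (𝒢.src g)) :
      TangentSpace J (𝒢.inv (𝒢.one (𝒢.src g)))) : TangentSpace J (𝒢.mul g (𝒢.one (𝒢.src g))))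

/-- The module generated over `C_c^∞(G)` by the right-invariant fields of the elements of `ℬ`. -/
def rightFoliation (𝒢 : LieGroupoid I M J G) (ℬ : Set (Π x : M, TangentSpace J (𝒢.one x))) :
    Set (Π g : G, TangentSpace J g) :=
  compactSpan J (𝒢.rightInvariant '' ℬ)

/-- The module generated over `C_c^∞(G)` by the left-invariant fields of the elements of `ℬ`. -/
def leftFoliation (𝒢 : LieGroupoid I M J G) (ℬ : Set (Π x : M, TangentSpace J (𝒢.one x))) :
    Set (Π g : G, TangentSpace J g) :=
  compactSpan J (𝒢.leftInvariant '' ℬ)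

/-- The smooth map `φ : U → G` is a bisubmersion for the submodule `ℬ ⊆ Γ_c(A)`. -/
structure IsBisubmersion (𝒢 : LieGroupoid I M J G)
    {E'' : Type*} [NormedAddCommGroup E''] [NormedSpace ℝ E'']
    {H'' : Type*} [TopologicalSpace H''] (K : ModelWithCorners ℝ E'' H'')
    {U : Type*} [TopologicalSpace U] [ChartedSpace H'' U] [IsManifold K 1 U]
    (ℬ : Set (Π x : M, TangentSpace J (𝒢.one x))) (φ : U → G) : Prop where
  smooth : ContMDiff K J ∞ φ
  src_submersion : Manifold.IsSubmersion K I ∞ (𝒢.src ∘ φ)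
  tgt_submersion : Manifold.IsSubmersion K I ∞ (𝒢.tgt ∘ φ)
  lift_right : ∀ α ∈ ℬ, ∃ Z : Π u : U, TangentSpace K u,
    SmoothField K Z ∧ Related K J φ Z (𝒢.rightInvariant α)
  lift_left : ∀ α ∈ ℬ, ∃ W : Π u : U, TangentSpace K u,
    SmoothField K W ∧ Related K J φ W (𝒢.leftInvariant α)
  pullback_right : pullbackFields K J φ (𝒢.rightFoliation ℬ) = compactKerFields K I (𝒢.src ∘ φ)
  pullback_left : pullbackFields K J φ (𝒢.leftFoliation ℬ) = compactKerFields K I (𝒢.tgt ∘ φ)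

end LieGroupoid

end LieGroupoids

section PairGroupoid

variable {E : Type*} [NormedAddCommGroup E] [NormedSpace ℝ E]
  {H : Type*} [TopologicalSpace H] (I : ModelWithCorners ℝ E H)
  (M : Type*) [TopologicalSpace M] [ChartedSpace H M]

theorem isSubmersion_fst [IsManifold I ∞ M] :
    Manifold.IsSubmersion (I.prod I) I ∞ (Prod.fst : M × M → M) := by
  refine Manifold.IsSubmersionOfComplement.isSubmersion (F := E) fun x => ?_
  refine Manifold.IsSubmersionAtOfComplement.mk_of_continuousAt continuous_fst.continuousAt
    (ContinuousLinearEquiv.refl ℝ (E × E)) (chartAt (ModelProd H H) x) (chartAt H x.1)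
    (mem_chart_source _ x) (mem_chart_source _ x.1)
    (IsManifold.chart_mem_maximalAtlas x) (IsManifold.chart_mem_maximalAtlas x.1) ?_
  intro y hy
  have h1 : y.1 ∈ (extChartAt I x.1).target := by
    have : y ∈ (extChartAt (I.prod I) x).target := hy
    rw [extChartAt_prod] at this
    exact this.1
  exact (extChartAt I x.1).right_inv h1

theorem isSubmersion_snd [IsManifold I ∞ M] :
    Manifold.IsSubmersion (I.prod I) I ∞ (Prod.snd : M × M → M) := by
  refine Manifold.IsSubmersionOfComplement.isSubmersion (F := E) fun x => ?_
  refine Manifold.IsSubmersionAtOfComplement.mk_of_continuousAt continuous_snd.continuousAt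
    (ContinuousLinearEquiv.prodComm ℝ E E) (chartAt (ModelProd H H) x) (chartAt H x.2)
    (mem_chart_source _ x) (mem_chart_source _ x.2)
    (IsManifold.chart_mem_maximalAtlas x) (IsManifold.chart_mem_maximalAtlas x.2) ?_
  intro y hy
  have h2 : y.2 ∈ (extChartAt I x.2).target := by
    have : y ∈ (extChartAt (I.prod I) x).target := hy
    rw [extChartAt_prod] at this
    exact this.2
  exact (extChartAt I x.2).right_inv h2

/-- The pair groupoid `M × M ⇉ M`, with `tgt (x, y) = x`, `src (x, y) = y` and
`(x, y) (y, z) = (x, z)`. -/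
def pairGroupoid [IsManifold I ∞ M] : LieGroupoid I M (I.prod I) (M × M) where
  src := Prod.snd
  tgt := Prod.fst
  one x := (x, x)
  inv g := (g.2, g.1)
  mul g h := (g.1, h.2)
  src_submersion := isSubmersion_snd I M
  tgt_submersion := isSubmersion_fst I M
  one_smooth := contMDiff_id.prodMk contMDiff_id
  inv_smooth := contMDiff_snd.prodMk contMDiff_fst
  mul_smooth := ((contMDiff_fst.comp contMDiff_fst).prodMk
    (contMDiff_snd.comp contMDiff_snd)).contMDiffOn
  src_one _ := rfl
  tgt_one _ := rfl
  src_inv _ := rfl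
  tgt_inv _ := rfl
  src_mul _ _ _ := rfl
  tgt_mul _ _ _ := rfl
  mul_assoc _ _ _ _ _ := rfl
  one_mul _ := rfl
  mul_one _ := rfl
  inv_mul _ := rfl
  mul_inv _ := rfl

variable {M}

/-- The section of the Lie algebroid of the pair groupoid that corresponds to a vector field `X`
on `M` under the isomorphism `T_x M ≅ ker (d src)_{(x, x)}`, the differential of `z ↦ (z, x)`
at `x` (its inverse is the anchor, the restriction of `d tgt`). -/
def pairSection [IsManifold I ∞ M] (X : Π x : M, TangentSpace I x) :
    Π x : M, TangentSpace (I.prod I) ((pairGroupoid I M).one x) := fun x =>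
  (mfderiv I (I.prod I) (fun z : M => (z, x)) x (X x) : TangentSpace (I.prod I) (x, x))

/-- `pairSection` maps `𝔛_c(M)` into the compactly supported sections of the Lie algebroid. -/
theorem pairSection_mem_compactSections [IsManifold I ∞ M] {X : Π x : M, TangentSpace I x}
    (hX : X ∈ compactFields I M) : pairSection I X ∈ (pairGroupoid I M).compactSections := by
  have h0 : pairSection I X = fun x => ((X x, 0) : E × E) := by
    funext x
    unfold pairSection
    rw [mfderiv_prod_left]; rfl
  refine ⟨?_, ?_, fun x => ?_⟩
  · have hz : ContMDiff I I.tangent ∞ (fun x => (⟨x, 0⟩ : TangentBundle I M)) :=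
      Bundle.contMDiff_zeroSection ℝ _
    have := (contMDiff_equivTangentBundleProd_symm (I := I) (I' := I) (M := M) (M' := M)
      (n := ∞)).comp (hX.1.prodMk hz)
    rw [h0]
    exact this
  · have : {x | pairSection I X x ≠ 0} = {x | X x ≠ 0} := by
      rw [h0]
      ext x
      exact not_congr ⟨fun h => congrArg Prod.fst h, fun h => Prod.ext h rfl⟩
    rw [this]
    exact hX.2
  · change mfderiv (I.prod I) I (Prod.snd : M × M → M) (x, x) (pairSection I X x) = 0
    unfold pairSection
    rw [mfderiv_snd, mfderiv_prod_left]; rfl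

/-- A singular foliation on `M`, as a singular subalgebroid of `TM`, regarded as the Lie algebroid
of the pair groupoid of `M`. -/
def SingularFoliation.pairSubalgebroid [IsManifold I ∞ M]
    (𝓕 : SingularFoliation I M) :
    Set (Π x : M, TangentSpace (I.prod I) ((pairGroupoid I M).one x)) :=
  pairSection I '' 𝓕.carrier

end PairGroupoid

section AndroulidakisSkandalis

variable {E : Type*} [NormedAddCommGroup E] [NormedSpace ℝ E]
  {H : Type*} [TopologicalSpace H] {I : ModelWithCorners ℝ E H}
  {M : Type*} [TopologicalSpace M] [ChartedSpace H M] [IsManifold I 1 M]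
  {E' : Type*} [NormedAddCommGroup E'] [NormedSpace ℝ E']
  {H' : Type*} [TopologicalSpace H'] (K : ModelWithCorners ℝ E' H')
  {U : Type*} [TopologicalSpace U] [ChartedSpace H' U] [IsManifold K 1 U]

/-- `(U, t, s)` is a bisubmersion, in the sense of Androulidakis and Skandalis, for the singular
foliation `𝓕` on `M`: `t` and `s` are submersions and
`t⁻¹(𝓕) = Γ_c(U, ker dt) + Γ_c(U, ker ds) = s⁻¹(𝓕)`. -/
structure SingularFoliation.IsASBisubmersion (𝓕 : SingularFoliation I M) (t s : U → M) :
    Prop where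
  tgt_submersion : Manifold.IsSubmersion K I ∞ t
  src_submersion : Manifold.IsSubmersion K I ∞ s
  pullback_tgt : pullbackFields K I t 𝓕.carrier =
    {Z | ∃ X ∈ compactKerFields K I t, ∃ Y ∈ compactKerFields K I s, Z = fun u => X u + Y u}
  pullback_src : pullbackFields K I s 𝓕.carrier =
    {Z | ∃ X ∈ compactKerFields K I t, ∃ Y ∈ compactKerFields K I s, Z = fun u => X u + Y u}

end AndroulidakisSkandalis

end SingFol

end

/-!
Write `φ = (t, s) : U → M × M`. On the pair groupoid the right- and left-invariant fields of a field
`X` on `M` are `(X, 0)` and `(0, X)` (`rightInvariant_pairSection`, `leftInvariant_pairSection`).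
Passing from a set of fields to the module it generates over `C_c^∞` does not change its pullback
(`pullbackFields_compactSpan`), so the pullback of the right-invariant foliation along `φ` is
`t⁻¹(𝓕) ∩ Γ_c(ker ds)`, and that of the left-invariant one is `s⁻¹(𝓕) ∩ Γ_c(ker dt)`. The pullback
condition on `φ` therefore says `Γ_c(ker ds) ⊆ t⁻¹(𝓕)` and `Γ_c(ker dt) ⊆ s⁻¹(𝓕)`, while the lifting
condition says that each `X ∈ 𝓕` lifts along `t` to a field tangent to the fibres of `s`, and along
`s` to a field tangent to the fibres of `t`.

For an Androulidakis–Skandalis bisubmersion, the pullback condition is immediate. For the lifting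
condition, lift `X` locally along the submersion `t`, cut the lift off so that it lies in `t⁻¹(𝓕) =
Γ_c(ker dt) + Γ_c(ker ds)`, and keep the component in `Γ_c(ker ds)`: it is a local lift tangent to
the fibres of `s`. Such lifts form a convex condition in each tangent space, so a partition of unity
gives a global one (`exists_lift_tangent_to_fibres`).

Conversely, given both conditions, the inclusion `⊇` in `t⁻¹(𝓕) = Γ_c(ker dt) + Γ_c(ker ds)` is the
pullback condition together with the trivial `Γ_c(ker dt) ⊆ t⁻¹(𝓕)`. For `⊆`, if `dt(Z) = ∑ fᵢ (Yᵢ ∘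
t)` and `Wᵢ` is the lift of `Yᵢ` tangent to the fibres of `s`, then `Z - ∑ fᵢ Wᵢ` lies in `ker dt`
and `∑ fᵢ Wᵢ` in `ker ds` (`exists_compactKerFields_of_lifts`). The argument for `s` is the same
with `t` and `s` exchanged.
-/

open Set Topology
open scoped Manifold ContDiff

noncomputable section

namespace SingFol

/-! ### Compactly supported functions and fields -/

section Fields

variable {E : Type*} [NormedAddCommGroup E] [NormedSpace ℝ E]
  {H : Type*} [TopologicalSpace H] {I : ModelWithCorners ℝ E H}
  {M : Type*} [TopologicalSpace M] [ChartedSpace H M]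

theorem fieldSupport_subset_of_forall {X : Π x : M, TangentSpace I x} {C : Set M}
    (hC : IsClosed C) (h : ∀ x, X x ≠ 0 → x ∈ C) : fieldSupport I X ⊆ C :=
  closure_minimal h hC

theorem eq_zero_of_notMem_fieldSupport {X : Π x : M, TangentSpace I x} {x : M}
    (hx : x ∉ fieldSupport I X) : X x = 0 := by
  by_contra h
  exact hx (subset_closure h)

theorem sub_mem_compactFields [IsManifold I 1 M] {X Y : Π x : M, TangentSpace I x}
    (hX : X ∈ compactFields I M) (hY : Y ∈ compactFields I M) :
    X - Y ∈ compactFields I M := by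
  refine ⟨ContMDiff.sub_section hX.1 hY.1, ?_⟩
  refine (hX.2.union hY.2).of_isClosed_subset isClosed_closure
    (fieldSupport_subset_of_forall (isClosed_closure.union isClosed_closure) fun x hx => ?_)
  by_contra h
  rw [mem_union, not_or] at h
  refine hx ?_
  change X x - Y x = 0
  rw [eq_zero_of_notMem_fieldSupport h.1, eq_zero_of_notMem_fieldSupport h.2, sub_zero]

theorem add_mem_compactFields [IsManifold I 1 M] {X Y : Π x : M, TangentSpace I x}
    (hX : X ∈ compactFields I M) (hY : Y ∈ compactFields I M) :
    (fun x => X x + Y x) ∈ compactFields I M := by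
  refine ⟨ContMDiff.add_section hX.1 hY.1, ?_⟩
  refine (hX.2.union hY.2).of_isClosed_subset isClosed_closure
    (fieldSupport_subset_of_forall (isClosed_closure.union isClosed_closure) fun x hx => ?_)
  by_contra h
  rw [mem_union, not_or] at h
  refine hx ?_
  rw [eq_zero_of_notMem_fieldSupport h.1, eq_zero_of_notMem_fieldSupport h.2, add_zero]

theorem sum_smul_mem_compactFields [IsManifold I 1 M] {n : ℕ} {f : Fin n → M → ℝ}
    {Z : Fin n → Π x : M, TangentSpace I x} (hf : ∀ i, f i ∈ compactFunctions I M)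
    (hZ : ∀ i, SmoothField I (Z i)) :
    (fun x => ∑ i, f i x • Z i x) ∈ compactFields I M := by
  refine ⟨ContMDiff.sum_section (t := fun i => f i • Z i)
    fun i _ => (hf i).1.smul_section (hZ i), ?_⟩
  have hC : IsCompact (⋃ i, tsupport (f i)) := isCompact_iUnion fun i => (hf i).2
  refine hC.of_isClosed_subset isClosed_closure
    (fieldSupport_subset_of_forall
      (isClosed_iUnion_of_finite fun i => isClosed_tsupport (f i)) fun x hx => ?_)
  by_contra h
  refine hx (Finset.sum_eq_zero fun i _ => ?_)
  rw [image_eq_zero_of_notMem_tsupport fun hi => h (mem_iUnion_of_mem i hi), zero_smul]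

/-- Smooth Urysohn lemma with compact support. -/
theorem exists_compactFunctions_eventuallyEq_one [FiniteDimensional ℝ E] [IsManifold I ∞ M]
    [T2Space M] [SigmaCompactSpace M] {C O : Set M} (hC : IsCompact C) (hO : IsOpen O)
    (hCO : C ⊆ O) :
    ∃ χ ∈ compactFunctions I M, (∀ᶠ x in 𝓝ˢ C, χ x = 1) ∧ tsupport χ ⊆ O := by
  have : LocallyCompactSpace H := I.locallyCompactSpace
  have : LocallyCompactSpace M := ChartedSpace.locallyCompactSpace H M
  obtain ⟨L, hL, hCL, hLO⟩ := exists_compact_between hC hO hCO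
  obtain ⟨χ, h1, h0, -⟩ := exists_contMDiffMap_one_nhds_of_subset_interior I (n := ⊤)
    hC.isClosed hCL
  have hsupp : tsupport χ ⊆ L :=
    closure_minimal (fun x hx => by_contra fun h => hx (h0 x h)) hL.isClosed
  exact ⟨χ, ⟨χ.contMDiff, hL.of_isClosed_subset (isClosed_tsupport _) hsupp⟩, h1,
    hsupp.trans hLO⟩

end Fields

/-! ### Pullbacks of modules of vector fields -/

section Pullback

variable {E : Type*} [NormedAddCommGroup E] [NormedSpace ℝ E]
  {H : Type*} [TopologicalSpace H] {I : ModelWithCorners ℝ E H}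
  {M : Type*} [TopologicalSpace M] [ChartedSpace H M] [IsManifold I 1 M]
  {E' : Type*} [NormedAddCommGroup E'] [NormedSpace ℝ E']
  {H' : Type*} [TopologicalSpace H'] {J : ModelWithCorners ℝ E' H'}
  {N : Type*} [TopologicalSpace N] [ChartedSpace H' N]

theorem mem_pullbackFields_of_fintype {ι : Type*} [Fintype ι] {φ : M → N}
    {𝒢 : Set (Π y : N, TangentSpace J y)} {X : Π x : M, TangentSpace I x}
    (hX : X ∈ compactFields I M) {f : ι → M → ℝ} {Y : ι → Π y : N, TangentSpace J y}
    (hf : ∀ i, f i ∈ compactFunctions I M) (hY : ∀ i, Y i ∈ 𝒢)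
    (h : ∀ p, mfderiv I J φ p (X p) = ∑ i, f i p • Y i (φ p)) :
    X ∈ pullbackFields I J φ 𝒢 := by
  let e := (Fintype.equivFin ι).symm
  refine ⟨hX, Fintype.card ι, fun k => f (e k), fun k => Y (e k), fun k => hf _, fun k => hY _,
    fun p => ?_⟩
  rw [h p]
  exact (e.sum_comp fun i => f i p • Y i (φ p)).symm

theorem compactKerFields_subset_pullbackFields {φ : M → N}
    (𝒢 : Set (Π y : N, TangentSpace J y)) :
    compactKerFields I J φ ⊆ pullbackFields I J φ 𝒢 := fun X hX =>
  mem_pullbackFields_of_fintype (ι := Fin 0) hX.1 (f := Fin.elim0) (Y := Fin.elim0)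
    (fun i => i.elim0) (fun i => i.elim0) fun p => by simpa using hX.2 p

theorem add_mem_pullbackFields {φ : M → N} {𝒢 : Set (Π y : N, TangentSpace J y)}
    {X Y : Π x : M, TangentSpace I x} (hX : X ∈ pullbackFields I J φ 𝒢)
    (hY : Y ∈ pullbackFields I J φ 𝒢) : (fun x => X x + Y x) ∈ pullbackFields I J φ 𝒢 := by
  obtain ⟨hXc, n, f, V, hf, hV, hfV⟩ := hX
  obtain ⟨hYc, m, g, W, hg, hW, hgW⟩ := hY
  refine mem_pullbackFields_of_fintype (ι := Fin n ⊕ Fin m) (add_mem_compactFields hXc hYc)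
    (f := Sum.elim f g) (Y := Sum.elim V W) ?_ ?_ fun p => ?_
  · rintro (i | i)
    exacts [hf i, hg i]
  · rintro (i | i)
    exacts [hV i, hW i]
  · rw [map_add, hfV, hgW, Fintype.sum_sum_type]
    rfl

/-- A set of vector fields and the module it generates over `C_c^∞` have the same pullback: a
coefficient `f ∈ C_c^∞(M)` absorbs a cutoff function on `N` that is `1` on `φ (supp f)`. -/
theorem pullbackFields_compactSpan [FiniteDimensional ℝ E'] [IsManifold J ∞ N] [T2Space N]
    [SigmaCompactSpace N] {φ : M → N} (hφ : ContMDiff I J ∞ φ)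
    (𝒢 : Set (Π y : N, TangentSpace J y)) :
    pullbackFields I J φ (compactSpan J 𝒢) = pullbackFields I J φ 𝒢 := by
  apply Subset.antisymm
  · rintro X ⟨hX, n, f, Y, hf, hY, h⟩
    choose m g W hg hW hgW using hY
    -- the coefficients are `f i * (g i j ∘ φ)`, where `Y i = ∑ j, g i j • W i j`
    refine mem_pullbackFields_of_fintype (ι := Σ i : Fin n, Fin (m i)) hX
      (f := fun k p => f k.1 p * g k.1 k.2 (φ p)) (Y := fun k => W k.1 k.2) (fun k => ?_)
      (fun k => hW _ _) fun p => ?_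
    · exact ⟨(hf k.1).1.mul ((hg k.1 k.2).1.comp hφ), (hf k.1).2.mul_right⟩
    · rw [h p, Fintype.sum_sigma]
      refine Finset.sum_congr rfl fun i _ => ?_
      rw [hgW i, Finset.smul_sum]
      exact Finset.sum_congr rfl fun j _ => smul_smul _ _ _
  · rintro X ⟨hX, n, f, Y, hf, hY, h⟩
    have hC : IsCompact (φ '' ⋃ i, tsupport (f i)) :=
      (isCompact_iUnion fun i => (hf i).2).image hφ.continuous
    obtain ⟨χ, hχ, h1, -⟩ :=
      exists_compactFunctions_eventuallyEq_one (I := J) hC isOpen_univ (subset_univ _)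
    refine ⟨hX, n, f, fun i y => χ y • Y i y, hf,
      fun i => ⟨1, fun _ => χ, fun _ => Y i, fun _ => hχ, fun _ => hY i, fun y => ?_⟩,
      fun p => ?_⟩
    · simp
    · rw [h p]
      refine Finset.sum_congr rfl fun i _ => ?_
      beta_reduce
      by_cases hp : p ∈ tsupport (f i)
      · rw [h1.self_of_nhdsSet _ (mem_image_of_mem φ (mem_iUnion_of_mem i hp)), one_smul]
      · rw [image_eq_zero_of_notMem_tsupport hp, zero_smul, zero_smul]

end Pullback

/-! ### Lifting vector fields along submersions -/

section Lift

variable {E : Type*} [NormedAddCommGroup E] [NormedSpace ℝ E]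
  {M : Type*} [TopologicalSpace M] [ChartedSpace E M]
  {E' : Type*} [NormedAddCommGroup E'] [NormedSpace ℝ E']
  {U : Type*} [TopologicalSpace U] [ChartedSpace E' U]

/-- Near `u`, a submersion `t` has a smooth family of local sections `h p`, parametrized by the
points `p` of the source, such that `h p` passes through `p`. -/
theorem exists_family_of_sections {F : Type*} [NormedAddCommGroup F] [NormedSpace ℝ F]
    {t : U → M} {u : U}
    (ht : Manifold.IsSubmersionAtOfComplement F 𝓘(ℝ, E') 𝓘(ℝ, E) ∞ t u) :
    ∃ (h : U → M → U) (V : Set U), IsOpen V ∧ u ∈ V ∧ ∀ p ∈ V,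
      h p (t p) = p ∧ (∀ᶠ y in 𝓝 (t p), t (h p y) = y) ∧
      ContMDiffAt (𝓘(ℝ, E').prod 𝓘(ℝ, E)) 𝓘(ℝ, E') ∞ (Function.uncurry h) (p, t p) := by
  set φ := ht.domChart
  set ψ := ht.codChart
  set e := ht.equiv
  -- in the charts `φ` and `ψ`, the map `t` is the projection `fst ∘ e`
  have hw : ∀ w ∈ φ.target, ψ (t (φ.symm w)) = (e w).1 := fun w hw => by
    have hw' : w ∈ (ht.domChart.extend 𝓘(ℝ, E')).target := by simpa using hw
    simpa using ht.writtenInCharts hw'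
  -- `h p y` has the base coordinate of `y` and the fibre coordinate of `p`
  refine ⟨fun p y => φ.symm (e.symm (ψ y, (e (φ p)).2)), φ.source, φ.open_source,
    ht.mem_domChart_source, fun p hp => ?_⟩
  have htp : t p ∈ ψ.source := ht.source_subset_preimage_source hp
  have hval : e.symm (ψ (t p), (e (φ p)).2) = φ p := by
    have h1 := hw (φ p) (φ.map_source hp)
    rw [φ.left_inv hp] at h1
    rw [h1]
    exact e.symm_apply_apply _
  have hψs := contMDiffAt_of_mem_maximalAtlas ht.codChart_mem_maximalAtlas htp
  have hφs := contMDiffAt_of_mem_maximalAtlas ht.domChart_mem_maximalAtlas hp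
  have hinner : ContMDiffAt (𝓘(ℝ, E').prod 𝓘(ℝ, E)) 𝓘(ℝ, E') ∞
      (fun q : U × M => e.symm (ψ q.2, (e (φ q.1)).2)) (p, t p) := by
    have h1 : ContMDiffAt (𝓘(ℝ, E').prod 𝓘(ℝ, E)) 𝓘(ℝ, E) ∞
        (fun q : U × M => ψ q.2) (p, t p) := hψs.comp (p, t p) contMDiffAt_snd
    have h2 : ContMDiffAt (𝓘(ℝ, E').prod 𝓘(ℝ, E)) 𝓘(ℝ, E') ∞
        (fun q : U × M => φ q.1) (p, t p) := hφs.comp (p, t p) contMDiffAt_fst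
    have h3 : ContMDiffAt (𝓘(ℝ, E').prod 𝓘(ℝ, E)) 𝓘(ℝ, F) ∞
        (fun q : U × M => (e (φ q.1)).2) (p, t p) :=
      (((ContinuousLinearMap.snd ℝ E F).comp (e : E' →L[ℝ] E × F)).contMDiff).contMDiffAt.comp
        (p, t p) h2
    exact ((e.symm : E × F →L[ℝ] E').contMDiff).contMDiffAt.comp (p, t p) (h1.prodMk_space h3)
  refine ⟨(congrArg φ.symm hval).trans (φ.left_inv hp), ?_, ?_⟩
  · have hc : ContinuousAt (fun y => e.symm (ψ y, (e (φ p)).2)) (t p) :=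
      e.symm.continuous.continuousAt.comp
        ((ψ.continuousAt htp).prodMk continuousAt_const)
    have hmem : ∀ᶠ y in 𝓝 (t p), e.symm (ψ y, (e (φ p)).2) ∈ φ.target :=
      hc.eventually_mem (by rw [hval]; exact φ.open_target.mem_nhds (φ.map_source hp))
    filter_upwards [hmem, ψ.open_source.mem_nhds htp] with y hy hys
    refine ψ.injOn (ht.source_subset_preimage_source (φ.map_target hy)) hys ?_
    rw [hw _ hy, e.apply_symm_apply]
  · refine ContMDiffAt.comp (p, t p) (g := φ.symm) ?_ hinner
    rw [hval]
    exact contMDiffAt_symm_of_mem_maximalAtlas ht.domChart_mem_maximalAtlas (φ.map_source hp)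

variable [IsManifold 𝓘(ℝ, E') ∞ U]

/-- A smooth vector field lifts locally along a submersion: differentiate, at each point `p`, the
local section through `p`. -/
theorem exists_local_lift [IsManifold 𝓘(ℝ, E) ∞ M] {t : U → M}
    (ht : Manifold.IsSubmersion 𝓘(ℝ, E') 𝓘(ℝ, E) ∞ t)
    {X : Π x : M, TangentSpace 𝓘(ℝ, E) x} (hX : SmoothField 𝓘(ℝ, E) X) (u : U) :
    ∃ (V : Set U) (Z : Π p : U, TangentSpace 𝓘(ℝ, E') p), IsOpen V ∧ u ∈ V ∧
      SmoothFieldOn 𝓘(ℝ, E') Z V ∧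
      ∀ p ∈ V, mfderiv 𝓘(ℝ, E') 𝓘(ℝ, E) t p (Z p) = X (t p) := by
  obtain ⟨h, V, hV, hu, H⟩ :=
    exists_family_of_sections (ht.isSubmersionOfComplement_complement u)
  have htc := ht.contMDiff
  have hh : ∀ p ∈ V, ContMDiffAt 𝓘(ℝ, E) 𝓘(ℝ, E') ∞ (h p) (t p) := fun p hp =>
    (H p hp).2.2.comp (t p) (f := fun y => (p, y)) (contMDiffAt_const.prodMk contMDiffAt_id)
  refine ⟨V, fun p => (mfderiv 𝓘(ℝ, E) 𝓘(ℝ, E') (h p) (t p) (X (t p)) :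
    TangentSpace 𝓘(ℝ, E') (h p (t p))), hV, hu, fun p hp => ?_, fun p hp => ?_⟩
  · have hA : ContMDiffAt 𝓘(ℝ, E') 𝓘(ℝ, E').tangent ∞
        (fun q => (⟨h q (t q), mfderiv 𝓘(ℝ, E) 𝓘(ℝ, E') (h q) (t q) (X (t q))⟩ :
          TangentBundle 𝓘(ℝ, E') U)) p := by
      refine ContMDiffAt.clm_apply_of_inCoordinates
        ((H p hp).2.2.mfderiv h t (htc p) le_rfl) ((hX.comp htc) p) ?_
      exact (H p hp).2.2.comp p (f := fun q => (q, t q)) (contMDiffAt_id.prodMk (htc p))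
    refine (hA.congr_of_eventuallyEq ?_).contMDiffWithinAt
    filter_upwards [hV.mem_nhds hp] with q hq
    -- `h q (t q)` and `q` agree only propositionally, so the base point has to be transported
    have key : ∀ (a b : U) (v : E'), a = b →
        (⟨a, v⟩ : TangentBundle 𝓘(ℝ, E') U) = ⟨b, v⟩ := by
      rintro a _ v rfl
      rfl
    exact key _ _ _ (H q hq).1.symm
  · have h1 : mfderiv 𝓘(ℝ, E) 𝓘(ℝ, E) (t ∘ h p) (t p) =
        ContinuousLinearMap.id ℝ (TangentSpace 𝓘(ℝ, E) (t p)) := by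
      have : t ∘ h p =ᶠ[𝓝 (t p)] id := (H p hp).2.1
      exact this.mfderiv_eq.trans mfderiv_id
    have h2 := mfderiv_comp_apply (t p) (I'' := 𝓘(ℝ, E)) (g := t)
      ((htc _).mdifferentiableAt (by simp)) ((hh p hp).mdifferentiableAt (by simp)) (X (t p))
    rw [h1] at h2
    rw [(H p hp).1] at h2
    exact h2.symm

/-- If, up to `ker dt`, the compactly supported fields in `t⁻¹(𝒢)` can be moved into `ker ds`, then
each field of `𝒢` lifts along `t` to a global field tangent to the fibres of `s`. Local lifts are
cut off, moved into `ker ds`, and averaged by a partition of unity. -/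
theorem exists_lift_tangent_to_fibres [IsManifold 𝓘(ℝ, E) ∞ M] [FiniteDimensional ℝ E'] [T2Space U]
    [SigmaCompactSpace U] {t s : U → M} (ht : Manifold.IsSubmersion 𝓘(ℝ, E') 𝓘(ℝ, E) ∞ t)
    {𝒢 : Set (Π x : M, TangentSpace 𝓘(ℝ, E) x)}
    (h𝒢 : ∀ Z ∈ pullbackFields 𝓘(ℝ, E') 𝓘(ℝ, E) t 𝒢,
      ∃ B ∈ compactKerFields 𝓘(ℝ, E') 𝓘(ℝ, E) s,
        ∀ p, mfderiv 𝓘(ℝ, E') 𝓘(ℝ, E) t p (Z p) = mfderiv 𝓘(ℝ, E') 𝓘(ℝ, E) t p (B p))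
    {X : Π x : M, TangentSpace 𝓘(ℝ, E) x} (hX : SmoothField 𝓘(ℝ, E) X) (hX𝒢 : X ∈ 𝒢) :
    ∃ Z : Π u : U, TangentSpace 𝓘(ℝ, E') u, SmoothField 𝓘(ℝ, E') Z ∧
      ∀ p, mfderiv 𝓘(ℝ, E') 𝓘(ℝ, E) t p (Z p) = X (t p) ∧
        mfderiv 𝓘(ℝ, E') 𝓘(ℝ, E) s p (Z p) = 0 := by
  suffices h : ∃ Z : Cₛ^∞⟮𝓘(ℝ, E'); E', fun u : U => TangentSpace 𝓘(ℝ, E') u⟯, ∀ p,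
      Z p ∈ {v | mfderiv 𝓘(ℝ, E') 𝓘(ℝ, E) t p v = X (t p) ∧
        mfderiv 𝓘(ℝ, E') 𝓘(ℝ, E) s p v = 0} by
    obtain ⟨Z, hZ⟩ := h
    exact ⟨Z, Z.contMDiff, hZ⟩
  refine exists_contMDiffSection_forall_mem_convex_of_local (n := ⊤) 𝓘(ℝ, E')
    (F_fiber := E') (fun u : U => TangentSpace 𝓘(ℝ, E') u) _ ?_ ?_
  · rintro p v ⟨hv, hv'⟩ w ⟨hw, hw'⟩ a b - - hab
    refine ⟨?_, ?_⟩
    · rw [map_add, map_smul, map_smul, hv, hw, ← add_smul, hab, one_smul]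
    · rw [map_add, map_smul, map_smul, hv', hw', smul_zero, smul_zero, add_zero]
  · intro u
    obtain ⟨V, Z, hV, hu, hZ, hZX⟩ := exists_local_lift ht hX u
    obtain ⟨χ, hχ, h1, hχV⟩ := exists_compactFunctions_eventuallyEq_one (I := 𝓘(ℝ, E'))
      isCompact_singleton hV (singleton_subset_iff.2 hu)
    rw [nhdsSet_singleton] at h1
    have hχZ : (χ • Z) ∈ compactFields 𝓘(ℝ, E') U := by
      refine ⟨ContMDiffOn.smul_section_of_tsupport hχ.1.contMDiffOn hV hχV hZ, ?_⟩
      refine hχ.2.of_isClosed_subset isClosed_closure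
        (fieldSupport_subset_of_forall (isClosed_tsupport χ) fun x hx => ?_)
      by_contra hn
      refine hx ?_
      change χ x • Z x = 0
      rw [image_eq_zero_of_notMem_tsupport hn, zero_smul]
    have hd : ∀ p, mfderiv 𝓘(ℝ, E') 𝓘(ℝ, E) t p ((χ • Z) p) = χ p • X (t p) := fun p => by
      change mfderiv 𝓘(ℝ, E') 𝓘(ℝ, E) t p (χ p • Z p) = χ p • X (t p)
      rw [map_smul]
      by_cases hp : p ∈ tsupport χ
      · rw [hZX p (hχV hp)]
      · rw [image_eq_zero_of_notMem_tsupport hp, zero_smul, zero_smul]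
    -- near `u`, where `χ = 1`, the field `B` is a lift of `X`
    obtain ⟨B, hB, hBt⟩ := h𝒢 (χ • Z) ⟨hχZ, 1, fun _ => χ, fun _ => X, fun _ => hχ,
      fun _ => hX𝒢, fun p => by simpa using hd p⟩
    refine ⟨_, h1, B, ContMDiff.contMDiffOn hB.1.1, fun p hp => ⟨?_, hB.2 p⟩⟩
    have hp1 : χ p = 1 := hp
    rw [← hBt, hd, hp1, one_smul]

/-- Existence of lifts tangent to the fibres of `s` splits `t⁻¹(𝒢)` as the sum of `Γ_c(ker dt)` and
`Γ_c(ker ds)`: subtract from a field the combination of lifts with the same image under `dt`. -/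
theorem exists_compactKerFields_of_lifts {t s : U → M}
    {𝒢 : Set (Π x : M, TangentSpace 𝓘(ℝ, E) x)}
    (hlift : ∀ X ∈ 𝒢, ∃ Z : Π u : U, TangentSpace 𝓘(ℝ, E') u, SmoothField 𝓘(ℝ, E') Z ∧
      ∀ p, mfderiv 𝓘(ℝ, E') 𝓘(ℝ, E) t p (Z p) = X (t p) ∧
        mfderiv 𝓘(ℝ, E') 𝓘(ℝ, E) s p (Z p) = 0)
    {Z : Π u : U, TangentSpace 𝓘(ℝ, E') u} (hZ : Z ∈ pullbackFields 𝓘(ℝ, E') 𝓘(ℝ, E) t 𝒢) :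
    ∃ A ∈ compactKerFields 𝓘(ℝ, E') 𝓘(ℝ, E) t, ∃ B ∈ compactKerFields 𝓘(ℝ, E') 𝓘(ℝ, E) s,
      Z = fun u => A u + B u := by
  obtain ⟨hZc, n, f, Y, hf, hY, h⟩ := hZ
  choose W hW hWY using fun i => hlift (Y i) (hY i)
  have hB : (fun u => ∑ i, f i u • W i u) ∈ compactFields 𝓘(ℝ, E') U :=
    sum_smul_mem_compactFields hf hW
  refine ⟨Z - fun u => ∑ i, f i u • W i u, ⟨sub_mem_compactFields hZc hB, fun p => ?_⟩, _,
    ⟨hB, fun p => ?_⟩, funext fun u => (sub_add_cancel (Z u) _).symm⟩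
  · change mfderiv 𝓘(ℝ, E') 𝓘(ℝ, E) t p (Z p - ∑ i, f i p • W i p) = 0
    rw [map_sub, h, map_sum, sub_eq_zero]
    refine Finset.sum_congr rfl fun i _ => ?_
    rw [map_smul, (hWY i p).1]
  · rw [map_sum]
    refine Finset.sum_eq_zero fun i _ => ?_
    rw [map_smul, (hWY i p).2, smul_zero]

end Lift

/-! ### Invariant vector fields on the pair groupoid -/

section Pair

variable {E : Type*} [NormedAddCommGroup E] [NormedSpace ℝ E]
  {H : Type*} [TopologicalSpace H] {I : ModelWithCorners ℝ E H}
  {M : Type*} [TopologicalSpace M] [ChartedSpace H M]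

/-- A differential within a subset `S`, evaluated on a vector in the image of the differential of a
map `c` into `S`, is determined by the composite. Derivatives within `S` need not be unique: on the
fibres of a groupoid `mfderivWithin` is a choice, and this lemma shows that the values of invariant
fields do not depend on it. -/
theorem mfderivWithin_apply_mfderiv
    {E₁ : Type*} [NormedAddCommGroup E₁] [NormedSpace ℝ E₁]
    {H₁ : Type*} [TopologicalSpace H₁] {I₁ : ModelWithCorners ℝ E₁ H₁}
    {M₁ : Type*} [TopologicalSpace M₁] [ChartedSpace H₁ M₁]
    {E₂ : Type*} [NormedAddCommGroup E₂] [NormedSpace ℝ E₂]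
    {H₂ : Type*} [TopologicalSpace H₂] {I₂ : ModelWithCorners ℝ E₂ H₂}
    {M₂ : Type*} [TopologicalSpace M₂] [ChartedSpace H₂ M₂]
    {f : M₁ → M₂} {S : Set M₁} {c : M → M₁} {x : M}
    (hf : MDifferentiableWithinAt I₁ I₂ f S (c x)) (hc : MDifferentiableAt I I₁ c x)
    (hcS : ∀ z, c z ∈ S) (v : TangentSpace I x) :
    mfderivWithin I₁ I₂ f S (c x) (mfderiv I I₁ c x v) = mfderiv I I₂ (f ∘ c) x v := by
  have h1 := HasMFDerivWithinAt.comp x hf.hasMFDerivWithinAt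
    (hc.hasMFDerivAt.hasMFDerivWithinAt (s := univ)) fun z _ => hcS z
  rw [hasMFDerivWithinAt_univ] at h1
  rw [h1.mfderiv]
  rfl

theorem mfderiv_pair_apply
    {E' : Type*} [NormedAddCommGroup E'] [NormedSpace ℝ E']
    {H' : Type*} [TopologicalSpace H'] {K : ModelWithCorners ℝ E' H'}
    {U : Type*} [TopologicalSpace U] [ChartedSpace H' U] {t s : U → M}
    (ht : ContMDiff K I ∞ t) (hs : ContMDiff K I ∞ s)
    (p : U) (v : TangentSpace K p) :
    mfderiv K (I.prod I) (fun u => (t u, s u)) p v =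
      ((mfderiv K I t p v, mfderiv K I s p v) : E × E) := by
  rw [((ht p).mdifferentiableAt (by simp)).mfderiv_prod ((hs p).mdifferentiableAt (by simp))]
  rfl

variable [IsManifold I ∞ M]

theorem rightInvariant_pairSection (X : Π x : M, TangentSpace I x) (g : M × M) :
    (pairGroupoid I M).rightInvariant (pairSection I X) g = ((X g.1, 0) : E × E) := by
  have hf : MDifferentiable (I.prod I) (I.prod I) (fun h : M × M => (h.1, g.2)) :=
    mdifferentiable_fst.prodMk mdifferentiable_const
  have hc : MDifferentiable I (I.prod I) (fun z : M => (z, g.1)) :=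
    mdifferentiable_id.prodMk mdifferentiable_const
  have := mfderivWithin_apply_mfderiv (S := {h : M × M | h.2 = g.1})
    (hf _).mdifferentiableWithinAt (hc g.1) (fun _ => rfl) (X g.1)
  refine this.trans ?_
  change mfderiv I (I.prod I) (fun z : M => (z, g.2)) g.1 (X g.1) = _
  rw [mfderiv_prod_left]
  rfl

theorem leftInvariant_pairSection (X : Π x : M, TangentSpace I x) (g : M × M) :
    (pairGroupoid I M).leftInvariant (pairSection I X) g = ((0, X g.2) : E × E) := by
  have hf : MDifferentiable (I.prod I) (I.prod I) (fun h : M × M => (g.1, h.2)) :=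
    mdifferentiable_const.prodMk mdifferentiable_snd
  have hc : MDifferentiable I (I.prod I) (fun z : M => (g.2, z)) :=
    mdifferentiable_const.prodMk mdifferentiable_id
  have hc' : MDifferentiable I (I.prod I) (fun z : M => (z, g.2)) :=
    mdifferentiable_id.prodMk mdifferentiable_const
  have hi : MDifferentiable (I.prod I) (I.prod I) (fun h : M × M => (h.2, h.1)) :=
    mdifferentiable_snd.prodMk mdifferentiable_fst
  -- the inversion turns the curve `z ↦ (z, g.2)` into `z ↦ (g.2, z)`
  have h1 := mfderiv_comp_apply g.2 (hi _) (hc' g.2) (X g.2)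
  have h2 := mfderivWithin_apply_mfderiv (S := {h : M × M | h.1 = g.2})
    (hf _).mdifferentiableWithinAt (hc g.2) (fun _ => rfl) (X g.2)
  have h3 : (pairGroupoid I M).leftInvariant (pairSection I X) g =
      mfderiv I (I.prod I) (fun z : M => (g.1, z)) g.2 (X g.2) := by
    refine Eq.trans ?_ h2
    exact congrArg (mfderivWithin (I.prod I) (I.prod I) (fun h : M × M => (g.1, h.2))
      {h : M × M | h.1 = g.2} (g.2, g.2)) h1.symm
  rw [h3, mfderiv_prod_right]
  rfl

variable [FiniteDimensional ℝ E] [T2Space M] [SigmaCompactSpace M]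
  {E' : Type*} [NormedAddCommGroup E'] [NormedSpace ℝ E']
  {H' : Type*} [TopologicalSpace H'] {K : ModelWithCorners ℝ E' H'}
  {U : Type*} [TopologicalSpace U] [ChartedSpace H' U] [IsManifold K 1 U]

/-- `(t, s)⁻¹` of the right-invariant foliation consists of the fields of `t⁻¹(𝓕)` tangent to the
fibres of `s`, since `𝓕` corresponds to the right-invariant fields `(X, 0)`. -/
theorem mem_pullbackFields_rightFoliation {t s : U → M} (ht : ContMDiff K I ∞ t)
    (hs : ContMDiff K I ∞ s) (𝓕 : SingularFoliation I M) {Z : Π u : U, TangentSpace K u} :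
    Z ∈ pullbackFields K (I.prod I) (fun u => (t u, s u))
        ((pairGroupoid I M).rightFoliation (𝓕.pairSubalgebroid I)) ↔
      Z ∈ pullbackFields K I t 𝓕.carrier ∧ ∀ p, mfderiv K I s p (Z p) = 0 := by
  rw [LieGroupoid.rightFoliation, pullbackFields_compactSpan (ht.prodMk hs)]
  constructor
  · rintro ⟨hZ, n, f, Y, hf, hY, h⟩
    choose α hα hαY using hY
    choose X hX hXα using hα
    have h' : ∀ p, ((mfderiv K I t p (Z p), mfderiv K I s p (Z p)) : E × E) =
        ∑ i, f i p • ((X i (t p), 0) : E × E) := fun p => by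
      rw [← mfderiv_pair_apply ht hs, h p]
      refine Finset.sum_congr rfl fun i _ => ?_
      rw [← hαY i, ← hXα i, rightInvariant_pairSection]
      rfl
    refine ⟨⟨hZ, n, f, X, hf, hX, fun p => ?_⟩, fun p => ?_⟩
    · refine (congrArg Prod.fst (h' p)).trans ?_
      rw [Prod.fst_sum]
      rfl
    · refine (congrArg Prod.snd (h' p)).trans ?_
      rw [Prod.snd_sum]
      exact Finset.sum_eq_zero fun i _ => smul_zero _
  · rintro ⟨⟨hZ, n, f, X, hf, hX, h⟩, h0⟩
    refine ⟨hZ, n, f, fun i => (pairGroupoid I M).rightInvariant (pairSection I (X i)), hf,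
      fun i => ⟨_, ⟨X i, hX i, rfl⟩, rfl⟩, fun p => ?_⟩
    rw [mfderiv_pair_apply ht hs]
    have : ∀ i, (pairGroupoid I M).rightInvariant (pairSection I (X i)) (t p, s p) =
        ((X i (t p), 0) : E × E) := fun i => rightInvariant_pairSection (X i) (t p, s p)
    simp only [this]
    refine Prod.ext ?_ ?_
    · refine (h p).trans (Eq.trans ?_ Prod.fst_sum.symm)
      rfl
    · refine (h0 p).trans (Eq.trans ?_ Prod.snd_sum.symm)
      exact (Finset.sum_eq_zero fun i _ => smul_zero _).symm

/-- `(t, s)⁻¹` of the left-invariant foliation consists of the fields of `s⁻¹(𝓕)` tangent to the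
fibres of `t`, since `𝓕` corresponds to the left-invariant fields `(0, X)`. -/
theorem mem_pullbackFields_leftFoliation {t s : U → M} (ht : ContMDiff K I ∞ t)
    (hs : ContMDiff K I ∞ s) (𝓕 : SingularFoliation I M) {Z : Π u : U, TangentSpace K u} :
    Z ∈ pullbackFields K (I.prod I) (fun u => (t u, s u))
        ((pairGroupoid I M).leftFoliation (𝓕.pairSubalgebroid I)) ↔
      Z ∈ pullbackFields K I s 𝓕.carrier ∧ ∀ p, mfderiv K I t p (Z p) = 0 := by
  rw [LieGroupoid.leftFoliation, pullbackFields_compactSpan (ht.prodMk hs)]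
  constructor
  · rintro ⟨hZ, n, f, Y, hf, hY, h⟩
    choose α hα hαY using hY
    choose X hX hXα using hα
    have h' : ∀ p, ((mfderiv K I t p (Z p), mfderiv K I s p (Z p)) : E × E) =
        ∑ i, f i p • ((0, X i (s p)) : E × E) := fun p => by
      rw [← mfderiv_pair_apply ht hs, h p]
      refine Finset.sum_congr rfl fun i _ => ?_
      rw [← hαY i, ← hXα i, leftInvariant_pairSection]
      rfl
    refine ⟨⟨hZ, n, f, X, hf, hX, fun p => ?_⟩, fun p => ?_⟩
    · refine (congrArg Prod.snd (h' p)).trans ?_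
      rw [Prod.snd_sum]
      rfl
    · refine (congrArg Prod.fst (h' p)).trans ?_
      rw [Prod.fst_sum]
      exact Finset.sum_eq_zero fun i _ => smul_zero _
  · rintro ⟨⟨hZ, n, f, X, hf, hX, h⟩, h0⟩
    refine ⟨hZ, n, f, fun i => (pairGroupoid I M).leftInvariant (pairSection I (X i)), hf,
      fun i => ⟨_, ⟨X i, hX i, rfl⟩, rfl⟩, fun p => ?_⟩
    rw [mfderiv_pair_apply ht hs]
    have : ∀ i, (pairGroupoid I M).leftInvariant (pairSection I (X i)) (t p, s p) =
        ((0, X i (s p)) : E × E) := fun i => leftInvariant_pairSection (X i) (t p, s p)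
    simp only [this]
    refine Prod.ext ?_ ?_
    · refine (h0 p).trans (Eq.trans ?_ Prod.fst_sum.symm)
      exact (Finset.sum_eq_zero fun i _ => smul_zero _).symm
    · refine (h p).trans (Eq.trans ?_ Prod.snd_sum.symm)
      rfl

end Pair

end SingFol

end

/-! ### Comparison of the two notions of bisubmersion -/

theorem mainTheorem10
    {E : Type*} [NormedAddCommGroup E] [NormedSpace ℝ E] [FiniteDimensional ℝ E]
    {M : Type*} [TopologicalSpace M] [T2Space M] [SecondCountableTopology M]
    [ChartedSpace E M] [IsManifold 𝓘(ℝ, E) ∞ M]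
    {E' : Type*} [NormedAddCommGroup E'] [NormedSpace ℝ E'] [FiniteDimensional ℝ E']
    {U : Type*} [TopologicalSpace U] [T2Space U] [SecondCountableTopology U]
    [ChartedSpace E' U] [IsManifold 𝓘(ℝ, E') ∞ U]
    (𝓕 : SingFol.SingularFoliation 𝓘(ℝ, E) M)
    (t s : U → M)
    (ht : Manifold.IsSubmersion 𝓘(ℝ, E') 𝓘(ℝ, E) ∞ t)
    (hs : Manifold.IsSubmersion 𝓘(ℝ, E') 𝓘(ℝ, E) ∞ s) :
    𝓕.IsASBisubmersion 𝓘(ℝ, E') t s ↔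
      (SingFol.pairGroupoid 𝓘(ℝ, E) M).IsBisubmersion 𝓘(ℝ, E')
        (𝓕.pairSubalgebroid 𝓘(ℝ, E)) (fun u => (t u, s u)) := by
  have : LocallyCompactSpace M := ChartedSpace.locallyCompactSpace E M
  have : LocallyCompactSpace U := ChartedSpace.locallyCompactSpace E' U
  have htc := ht.contMDiff
  have hsc := hs.contMDiff
  constructor
  · intro h
    have hleft : SingFol.compactKerFields 𝓘(ℝ, E') 𝓘(ℝ, E) t ⊆
        SingFol.pullbackFields 𝓘(ℝ, E') 𝓘(ℝ, E) s 𝓕.carrier := fun Z hZ => by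
      rw [h.pullback_src, ← h.pullback_tgt]
      exact SingFol.compactKerFields_subset_pullbackFields _ hZ
    have hright : SingFol.compactKerFields 𝓘(ℝ, E') 𝓘(ℝ, E) s ⊆
        SingFol.pullbackFields 𝓘(ℝ, E') 𝓘(ℝ, E) t 𝓕.carrier := fun Z hZ => by
      rw [h.pullback_tgt, ← h.pullback_src]
      exact SingFol.compactKerFields_subset_pullbackFields _ hZ
    refine ⟨htc.prodMk hsc, hs, ht, ?_, ?_, ?_, ?_⟩
    · rintro _ ⟨X, hX, rfl⟩
      obtain ⟨Z, hZ, hZX⟩ := SingFol.exists_lift_tangent_to_fibres (s := s) ht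
        (𝒢 := 𝓕.carrier) (fun Z hZ => by
          rw [h.pullback_tgt] at hZ
          obtain ⟨A, hA, B, hB, rfl⟩ := hZ
          exact ⟨B, hB, fun p => by rw [map_add, hA.2 p, zero_add]⟩)
        (𝓕.subset_compactFields hX).1 hX
      refine ⟨Z, hZ, fun p => ?_⟩
      rw [SingFol.mfderiv_pair_apply htc hsc, SingFol.rightInvariant_pairSection, (hZX p).1,
        (hZX p).2]
      rfl
    · rintro _ ⟨X, hX, rfl⟩
      obtain ⟨Z, hZ, hZX⟩ := SingFol.exists_lift_tangent_to_fibres (s := t) hs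
        (𝒢 := 𝓕.carrier) (fun Z hZ => by
          rw [h.pullback_src] at hZ
          obtain ⟨A, hA, B, hB, rfl⟩ := hZ
          exact ⟨A, hA, fun p => by rw [map_add, hB.2 p, add_zero]⟩)
        (𝓕.subset_compactFields hX).1 hX
      refine ⟨Z, hZ, fun p => ?_⟩
      rw [SingFol.mfderiv_pair_apply htc hsc, SingFol.leftInvariant_pairSection, (hZX p).1,
        (hZX p).2]
      rfl
    · ext Z
      rw [SingFol.mem_pullbackFields_rightFoliation htc hsc]
      exact ⟨fun hZ => ⟨hZ.1.1, hZ.2⟩, fun hZ => ⟨hright hZ, hZ.2⟩⟩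
    · ext Z
      rw [SingFol.mem_pullbackFields_leftFoliation htc hsc]
      exact ⟨fun hZ => ⟨hZ.1.1, hZ.2⟩, fun hZ => ⟨hleft hZ, hZ.2⟩⟩
  · intro h
    have hright : SingFol.compactKerFields 𝓘(ℝ, E') 𝓘(ℝ, E) s ⊆
        SingFol.pullbackFields 𝓘(ℝ, E') 𝓘(ℝ, E) t 𝓕.carrier := fun Z hZ =>
      ((SingFol.mem_pullbackFields_rightFoliation htc hsc 𝓕).1
        (h.pullback_right.symm ▸ hZ)).1
    have hleft : SingFol.compactKerFields 𝓘(ℝ, E') 𝓘(ℝ, E) t ⊆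
        SingFol.pullbackFields 𝓘(ℝ, E') 𝓘(ℝ, E) s 𝓕.carrier := fun Z hZ =>
      ((SingFol.mem_pullbackFields_leftFoliation htc hsc 𝓕).1
        (h.pullback_left.symm ▸ hZ)).1
    refine ⟨ht, hs, Set.Subset.antisymm (fun Z hZ => ?_) ?_,
      Set.Subset.antisymm (fun Z hZ => ?_) ?_⟩
    · refine SingFol.exists_compactKerFields_of_lifts (fun X hX => ?_) hZ
      obtain ⟨W, hW, hWX⟩ := h.lift_right _ ⟨X, hX, rfl⟩
      refine ⟨W, hW, fun p => ?_⟩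
      have := hWX p
      rw [SingFol.mfderiv_pair_apply htc hsc, SingFol.rightInvariant_pairSection] at this
      exact ⟨congrArg Prod.fst this, congrArg Prod.snd this⟩
    · rintro _ ⟨A, hA, B, hB, rfl⟩
      exact SingFol.add_mem_pullbackFields
        (SingFol.compactKerFields_subset_pullbackFields _ hA) (hright hB)
    · obtain ⟨B, hB, A, hA, rfl⟩ :=
        SingFol.exists_compactKerFields_of_lifts (t := s) (s := t) (fun X hX => by
          obtain ⟨W, hW, hWX⟩ := h.lift_left _ ⟨X, hX, rfl⟩
          refine ⟨W, hW, fun p => ?_⟩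
          have := hWX p
          rw [SingFol.mfderiv_pair_apply htc hsc, SingFol.leftInvariant_pairSection] at this
          exact ⟨congrArg Prod.snd this, congrArg Prod.fst this⟩) hZ
      exact ⟨A, hA, B, hB, funext fun u => add_comm _ _⟩
    · rintro _ ⟨A, hA, B, hB, rfl⟩
      exact SingFol.add_mem_pullbackFields (hleft hA)
        (SingFol.compactKerFields_subset_pullbackFields _ hB)
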